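/- Let $N=2m$ with $m\ge 1$, and let $\mathcal T=(t_{i_1\cdots i_N})\in\mathbb H^{I_1\times\cdots\times I_N}$ be a quaternion tensor. Notation. For quaternion matrices $U=(u_{ij}), V=(v_{ij})\in\mathbb H^{I_k\times I_k}$ the left and right mode-$k$ products are $$(U\times^L_k\mathcal T)_{i_1\cdots j\cdots i_N}=\sum_{i_k=1}^{I_k}u_{j i_k}t_{i_1\cdots i_k\cdots i_N},\qquad (\mathcal T\times^R_k V)_{i_1\cdots j\cdots i_N}=\sum_{i_k=1}^{I_k}t_{i_1\cdots i_k\cdots i_N}v_{i_k j},$$ where $j$ stands in position $k$. The left mode-$k$ unfolding $\mathcal T^L_{[k]}$ is the $I_k\times\prod_{l\ne k}I_l$ matrix whose $(i_k,j)$ entry, $j=1+\sum_{l\neq k}(i_l-1)\prod_{r<l,\,r\ne k}I_r$, is $t_{i_1\cdots i_N}$, and the right unfolding is $\mathcal T^R_{[k]}=(\mathcal T^L_{[k]})^T$. A singular value decomposition (SVD) of $A\in\mathbb H^{a\times b}$ is a factorization $A=W\Sigma Z^H$ with $W\in\mathbb H^{a\times a}$, $Z\in\mathbb H^{b\times b}$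 unitary and $\Sigma\in\mathbb R^{a\times b}$ diagonal with diagonal entries $\sigma_1\ge\sigma_2\ge\cdots\ge 0$, the singular values of $A$; put $\sigma_i=0$ for $i>\min(a,b)$. For tensors of the same size, $\langle\mathcal A,\mathcal B\rangle_L=\sum a_{i_1i_2\cdots}\overline{b_{i_1i_2\cdots}}$, $\langle\mathcal A,\mathcal B\rangle_R=\sum\overline{a_{i_1i_2\cdots}}\,b_{i_1i_2\cdots}$ and $\|\mathcal A\|_F^2=\langle\mathcal A,\mathcal A\rangle_L$. $\mathcal S_{i_k=\alpha}$ is the subtensor of order $N-1$ obtained by fixing the $k$-th index of $\mathcal S$ to be $\alpha$. Products without parentheses are formed starting from the tensor (a left and a right product in different modes commute). Construction. For $k=m,m-1,\dots,1$ let $$\mathcal T_{k+1}=U_{k+1}^H\times^L_{k+1}\cdots U_m^H\times^L_m\mathcal T\times^R_{m+1}V_{m+1}\cdots\times^R_{N-k}V_{N-k}$$ (so $\mathcal T_{m+1}=\mathcal T$), and let the unitary matrices $U_k\in\mathbb H^{I_k\times I_k}$ and $V_{N-k+1}\in\mathbb H^{I_{N-k+1}\times I_{N-k+1}}$ be taken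 from any SVDs $$(\mathcal T_{k+1})^L_{[k]}=U_k\Sigma^L_kZ_k^H,\qquad (\mathcal T_{k+1})^R_{[N-k+1]}=W_{N-k+1}\Sigma^R_{N-k+1}V_{N-k+1}^H .$$ Let $\mathcal S=U_1^H\times^L_1\cdots U_m^H\times^L_m\mathcal T\times^R_{m+1}V_{m+1}\cdots\times^R_NV_N$. Theorem (two-sided QHOSVD). Such matrices $U_1,\dots,U_m,V_{m+1},\dots,V_N$ exist, and for every such choice $$\mathcal T=U_m\times^L_m\cdots U_1\times^L_1\mathcal S\times^R_NV_N^H\cdots\times^R_{m+1}V_{m+1}^H .$$ Moreover, $\mathcal S$ has the following properties. (i) Ordering: for $p=1,\dots,m$ and $q=m+1,\dots,N$, $$\|\mathcal S_{i_p=1}\|_F=\sigma^{(p)}_1\ge\cdots\ge\|\mathcal S_{i_p=I_p}\|_F=\sigma^{(p)}_{I_p}\ge0,\qquad \|\mathcal S_{i_q=1}\|_F=\sigma^{(q)}_1\ge\cdots\ge\|\mathcal S_{i_q=I_q}\|_F=\sigma^{(q)}_{I_q}\ge0,$$ where $\sigma^{(p)}_i$ are the singular values of $(\mathcal T_{p+1})^L_{[p]}$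 and $\sigma^{(q)}_i$ those of $(\mathcal T_{N-q+2})^R_{[q]}$, in descending order. (ii) Orthogonality: $\langle\mathcal S_{i_1=\alpha},\mathcal S_{i_1=\beta}\rangle_L=0$ and $\langle\mathcal S_{i_N=\alpha},\mathcal S_{i_N=\beta}\rangle_R=0$ whenever $\alpha\ne\beta$. (iii) Weak orthogonality: for every $k=1,\dots,N$, $\operatorname{Re}\langle\mathcal S_{i_k=\alpha},\mathcal S_{i_k=\beta}\rangle_L=\operatorname{Re}\langle\mathcal S_{i_k=\alpha},\mathcal S_{i_k=\beta}\rangle_R=0$ whenever $\alpha\neq\beta$. -/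

import Mathlib

open scoped Quaternion Matrix

/-- Quaternion tensors of order `N` and size `I 0 × ⋯ × I (N - 1)`. Modes and indices are numbered
from zero. -/
abbrev QTensor {N : ℕ} (I : Fin N → ℕ) : Type := (∀ l, Fin (I l)) → ℍ[ℝ]

/-- Quaternion matrices with `a` rows and `b` columns. -/
abbrev QMatrix (a b : ℕ) : Type := Matrix (Fin a) (Fin b) ℍ[ℝ]

namespace QTensor

section Inner

variable {N : ℕ} {I : Fin N → ℕ}

/-- Left inner product `∑ a_i * conj b_i`. -/
noncomputable def innerL (A B : QTensor I) : ℍ[ℝ] := ∑ i, A i * star (B i)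

/-- Right inner product `∑ conj a_i * b_i`. -/
noncomputable def innerR (A B : QTensor I) : ℍ[ℝ] := ∑ i, star (A i) * B i

/-- Frobenius norm; `innerL A A` is a nonnegative real. -/
noncomputable def frobNorm (A : QTensor I) : ℝ := Real.sqrt (innerL A A).re

/-- Left orthogonality of two tensors. -/
def LeftOrthogonal (A B : QTensor I) : Prop := innerL A B = 0

/-- Right orthogonality of two tensors. -/
def RightOrthogonal (A B : QTensor I) : Prop := innerR A B = 0

/-- Weak orthogonality: the real parts of both inner products vanish. -/
def WeaklyOrthogonal (A B : QTensor I) : Prop := (innerL A B).re = 0 ∧ (innerR A B).re = 0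

/-- Left mode-`k` product with a square matrix, `y_{… j …} = ∑ r, u_{j r} * t_{… r …}`. -/
noncomputable def leftProd (k : Fin N) (U : QMatrix (I k) (I k)) (T : QTensor I) : QTensor I :=
  fun i => ∑ r, U (i k) r * T (Function.update i k r)

/-- Right mode-`k` product with a square matrix, `y_{… j …} = ∑ r, t_{… r …} * v_{r j}`. -/
noncomputable def rightProd (k : Fin N) (T : QTensor I) (V : QMatrix (I k) (I k)) : QTensor I :=
  fun i => ∑ r, T (Function.update i k r) * V r (i k)

end Inner

section Unfold

variable {n : ℕ} {I : Fin (n + 1) → ℕ}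

/-- The subtensor of order `n` obtained by fixing the `k`-th index to be `α`. -/
def subtensor (T : QTensor I) (k : Fin (n + 1)) (α : Fin (I k)) :
    QTensor (fun l : Fin n => I (k.succAbove l)) :=
  fun j => T (k.insertNth α j)

/-- Left mode-`k` unfolding, with the mode-`k` fibers as columns. The remaining indices are
enumerated with the first one running fastest: `finPiFinEquiv` sends `(j_l)` to
`∑ l, j_l * ∏ r < l, I_r`, where `l` and `r` run through the modes other than `k`. -/
def unfoldL (k : Fin (n + 1)) (T : QTensor I) : QMatrix (I k) (∏ l : Fin n, I (k.succAbove l)) :=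
  Matrix.of fun a c => T (k.insertNth a (finPiFinEquiv.symm c))

/-- Right mode-`k` unfolding, with the mode-`k` fibers as rows, the remaining indices being
enumerated as in `unfoldL`. -/
def unfoldR (k : Fin (n + 1)) (T : QTensor I) : QMatrix (∏ l : Fin n, I (k.succAbove l)) (I k) :=
  Matrix.of fun c a => T (k.insertNth a (finPiFinEquiv.symm c))

end Unfold

end QTensor

/-- The rectangular `a × b` matrix with the real numbers `σ 0, σ 1, …` on its diagonal. -/
noncomputable def rectDiag (a b : ℕ) (σ : ℕ → ℝ) : QMatrix a b :=
  Matrix.of fun i j => if i.val = j.val then ((σ i.val : ℝ) : ℍ[ℝ]) else 0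

/-- `A = U Σ Vᴴ` is a singular value decomposition: `U` and `V` are unitary, and `Σ` is the real
rectangular diagonal matrix with nonnegative diagonal `σ` in descending order. The sequence `σ` is
continued by zeros after the `min a b` diagonal positions. -/
structure IsQSVD {a b : ℕ} (A : QMatrix a b) (U : QMatrix a a) (σ : ℕ → ℝ) (V : QMatrix b b) :
    Prop where
  unitary_left : U ∈ unitary (QMatrix a a)
  unitary_right : V ∈ unitary (QMatrix b b)
  antitone : Antitone σ
  nonneg : ∀ i, 0 ≤ σ i
  eq_zero : ∀ i, min a b ≤ i → σ i = 0
  eq : A = U * rectDiag a b σ * Vᴴ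

/-- `σ` is the sequence of singular values of `A` in descending order, continued by zeros. -/
def IsSingularValues {a b : ℕ} (A : QMatrix a b) (σ : ℕ → ℝ) : Prop :=
  ∃ U V, IsQSVD A U σ V

namespace TSQHOSVD

open QTensor

/-- The `k`-th mode in the first half of the `N = n + 1 = 2 * m` modes. -/
def leftMode {n m : ℕ} (hN : n + 1 = 2 * m) (k : Fin m) : Fin (n + 1) := ⟨k.val, by omega⟩

/-- The mode in the second half that is paired with the `k`-th mode: the `k`-th mode counted from
the last one. -/
def rightMode {n m : ℕ} (hN : n + 1 = 2 * m) (k : Fin m) : Fin (n + 1) := (leftMode hN k).rev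

variable {n m : ℕ} {I : Fin (n + 1) → ℕ} (hN : n + 1 = 2 * m)

/-- Square matrices `U_k` acting on the modes of the first half. -/
abbrev LeftFactors (I : Fin (n + 1) → ℕ) : Type :=
  ∀ k : Fin m, QMatrix (I (leftMode hN k)) (I (leftMode hN k))

/-- Square matrices acting on the modes of the second half; the one with number `k` acts on
`rightMode hN k`. -/
abbrev RightFactors (I : Fin (n + 1) → ℕ) : Type :=
  ∀ k : Fin m, QMatrix (I (rightMode hN k)) (I (rightMode hN k))

/-- For `ks = [k₁, …, k_r]`, the tensor `U_{k₁} ×ᴸ (U_{k₂} ×ᴸ ⋯ (U_{k_r} ×ᴸ T))`. -/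
noncomputable def leftProds (U : LeftFactors hN I) (ks : List (Fin m)) (T : QTensor I) :
    QTensor I :=
  ks.foldr (fun k X => leftProd (leftMode hN k) (U k) X) T

/-- For `ks = [k₁, …, k_r]`, the tensor `((T ×ᴿ V_{k₁}) ×ᴿ V_{k₂}) ⋯ ×ᴿ V_{k_r}`. -/
noncomputable def rightProds (T : QTensor I) (V : RightFactors hN I) (ks : List (Fin m)) :
    QTensor I :=
  ks.foldl (fun X k => rightProd (rightMode hN k) X (V k)) T

/-- The partially multiplied tensor
`U_sᴴ ×ᴸ ⋯ U_{m-1}ᴴ ×ᴸ T ×ᴿ V_{m-1} ×ᴿ ⋯ V_s`: the pairs `s, …, m - 1` have been applied to `T`,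
starting with the pair `m - 1`. -/
noncomputable def partialTensor (U : LeftFactors hN I) (V : RightFactors hN I) (T : QTensor I)
    (s : ℕ) : QTensor I :=
  rightProds hN (leftProds hN (fun k => (U k)ᴴ) ((List.finRange m).drop s) T) V
    ((List.finRange m).drop s).reverse

/-- The core tensor: all the pairs have been applied. -/
noncomputable def core (U : LeftFactors hN I) (V : RightFactors hN I) (T : QTensor I) :
    QTensor I :=
  partialTensor hN U V T 0

/-- `U_{m-1} ×ᴸ ⋯ U_0 ×ᴸ S ×ᴿ V_0ᴴ ×ᴿ ⋯ V_{m-1}ᴴ`. -/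
noncomputable def reconstruct (U : LeftFactors hN I) (V : RightFactors hN I) (S : QTensor I) :
    QTensor I :=
  rightProds hN (leftProds hN U (List.finRange m).reverse S) (fun k => (V k)ᴴ) (List.finRange m)

/-- The matrix whose left singular vectors form `U_k`. -/
noncomputable def leftMatrix (U : LeftFactors hN I) (V : RightFactors hN I) (T : QTensor I)
    (k : Fin m) :
    QMatrix (I (leftMode hN k)) (∏ l : Fin n, I ((leftMode hN k).succAbove l)) :=
  unfoldL (leftMode hN k) (partialTensor hN U V T (k.val + 1))

/-- The matrix whose right singular vectors form `V_k`. -/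
noncomputable def rightMatrix (U : LeftFactors hN I) (V : RightFactors hN I) (T : QTensor I)
    (k : Fin m) :
    QMatrix (∏ l : Fin n, I ((rightMode hN k).succAbove l)) (I (rightMode hN k)) :=
  unfoldR (rightMode hN k) (partialTensor hN U V T (k.val + 1))

/-- The factors are taken from singular value decompositions of the unfoldings of the partially
multiplied tensors. -/
structure IsFactors (T : QTensor I) (U : LeftFactors hN I) (V : RightFactors hN I) : Prop where
  left : ∀ k, ∃ σ W, IsQSVD (leftMatrix hN U V T k) (U k) σ W
  right : ∀ k, ∃ W σ, IsQSVD (rightMatrix hN U V T k) W σ (V k)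

end TSQHOSVD

open QTensor TSQHOSVD

/-!
The theorem rests on two facts about quaternion matrices, the existence of a singular value
decomposition (`exists_isQSVD`) and the uniqueness of the singular values
(`IsQSVD.singularValues_unique`), and on the way unitary mode products act on inner products of
slices.

Existence of the decomposition is variational. Let `C` be a real `b × a` diagonal matrix with
positive, strictly decreasing diagonal, and let `B = Uᴴ A V` maximize `Re tr (C B)` over the compact
set of pairs of unitary matrices. Multiplying `B` by unitary matrices `1 + w (p - 1) wᴴ / |w|²` with
`|p| = 1` shows that `B C` and `C B` are Hermitian with nonnegative diagonal
(`hermitian_of_re_trace_le`). Comparing the two gives `(c_i² - c_j²) B_ij = 0`, so `B` is diagonal,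
and exchanging two diagonal entries shows that they are in descending order.

For uniqueness, two decompositions of `A` yield a unitary `H` with `D H = H D'`, where `D` and `D'`
carry the squared singular values. The numbers `|H_ij|²` form a doubly stochastic matrix supported
where `D_i = D'_j`, so `D` and `D'` have the same entries with the same multiplicities.

The factors exist because the two unfoldings for the pair `k` involve only the factors with larger
number. Let `T_k` be `partialTensor` at `k`; then `T_k = U_kᴴ ×ᴸ T_{k+1} ×ᴿ V_k`. A unitary left
product in another mode preserves the right inner products of slices, a unitary right product
preserves the left ones, and the real parts of both inner products agree. In the mode of `U_k` the
slices of `U_kᴴ ×ᴸ T_{k+1}` have left Gram matrix `Σ Σᵀ`, and the right product with `V_k` keeps it;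
in the mode of `V_k` the right Gram matrix is likewise `Σᵀ Σ`. For `k = 0` these are the
orthogonality relations of the core. For larger `k` the remaining factors act in other modes but on
both sides, so only the real part survives (`IsFactors.re_innerL_core`); it gives the norms of the
slices and the weak orthogonality.
-/

/-! ### Quaternions -/

lemma Quaternion.re_mul_comm (p q : ℍ[ℝ]) : (p * q).re = (q * p).re := by
  simp only [Quaternion.re_mul]; ring

lemma Quaternion.re_sum {ι : Type*} (s : Finset ι) (f : ι → ℍ[ℝ]) :
    (∑ i ∈ s, f i).re = ∑ i ∈ s, (f i).re := by
  classical
  induction s using Finset.induction_on with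
  | empty => simp
  | insert a s ha ih => simp [Finset.sum_insert ha, ih]

lemma Quaternion.norm_mul_norm_eq (p : ℍ[ℝ]) :
    ‖p‖ * ‖p‖ = p.re ^ 2 + p.imI ^ 2 + p.imJ ^ 2 + p.imK ^ 2 := by
  rw [← Quaternion.normSq_eq_norm_mul_self, Quaternion.normSq_def']

/-- A quaternion whose real part is not increased by any rotation is a nonnegative real. -/
lemma Quaternion.eq_coe_of_forall_re_mul_le {z : ℍ[ℝ]}
    (h : ∀ p : ℍ[ℝ], p * star p = 1 → (p * z).re ≤ z.re) : 0 ≤ z.re ∧ z = (z.re : ℍ[ℝ]) := by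
  have key : ‖z‖ ≤ z.re := by
    rcases eq_or_ne z 0 with rfl | hz
    · simp
    have hz' : ‖z‖ ≠ 0 := norm_ne_zero_iff.mpr hz
    -- The rotation `p = star z / ‖z‖` takes `z` to `‖z‖`.
    have h1 := h (((‖z‖⁻¹ : ℝ) : ℍ[ℝ]) * star z) (by
      rw [star_mul, star_star, Quaternion.star_coe, mul_assoc, ← mul_assoc (star z),
        Quaternion.star_mul_self, Quaternion.normSq_eq_norm_mul_self]
      norm_cast
      field_simp
      exact Quaternion.coe_one)
    rw [mul_assoc, Quaternion.star_mul_self, Quaternion.normSq_eq_norm_mul_self] at h1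
    have h2 : (((‖z‖⁻¹ : ℝ) : ℍ[ℝ]) * ((‖z‖ * ‖z‖ : ℝ) : ℍ[ℝ])).re = ‖z‖ := by
      rw [← Quaternion.coe_mul, Quaternion.re_coe]
      field_simp
    rwa [h2] at h1
  have h0 := (norm_nonneg z).trans key
  refine ⟨h0, ?_⟩
  have h2 := Quaternion.norm_mul_norm_eq z
  have h3 : z.imI ^ 2 + z.imJ ^ 2 + z.imK ^ 2 ≤ 0 := by nlinarith [norm_nonneg z]
  have hi : z.imI = 0 := by nlinarith [sq_nonneg z.imI, sq_nonneg z.imJ, sq_nonneg z.imK]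
  have hj : z.imJ = 0 := by nlinarith [sq_nonneg z.imI, sq_nonneg z.imJ, sq_nonneg z.imK]
  have hk : z.imK = 0 := by nlinarith [sq_nonneg z.imI, sq_nonneg z.imJ, sq_nonneg z.imK]
  ext <;> simp [hi, hj, hk]

/-! ### Unitary matrices and a trace inequality -/

section Trace

variable {ι κ : Type*}

/-- The matrix `1 + w s wᴴ` for a scalar `s` and a column `w`, encoded as a matrix with columns
indexed by `Unit`. -/
noncomputable def rankOneUpdate [DecidableEq ι] (w : Matrix ι Unit ℍ[ℝ]) (s : ℍ[ℝ]) :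
    Matrix ι ι ℍ[ℝ] :=
  1 + w * (Matrix.of fun _ _ => s : Matrix Unit Unit ℍ[ℝ]) * wᴴ

lemma rankOneUpdate_conjTranspose [DecidableEq ι] (w : Matrix ι Unit ℍ[ℝ]) (s : ℍ[ℝ]) :
    (rankOneUpdate w s)ᴴ = rankOneUpdate w (star s) := by
  have : (Matrix.of fun _ _ => s : Matrix Unit Unit ℍ[ℝ])ᴴ = Matrix.of fun _ _ => star s := by
    ext1; simp
  simp [rankOneUpdate, Matrix.conjTranspose_mul, this, Matrix.mul_assoc]

variable [Fintype ι] [Fintype κ]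

lemma re_trace_mul_comm (A : Matrix ι κ ℍ[ℝ]) (B : Matrix κ ι ℍ[ℝ]) :
    (A * B).trace.re = (B * A).trace.re := by
  simp only [Matrix.trace, Matrix.diag_apply, Matrix.mul_apply, Quaternion.re_sum]
  rw [Finset.sum_comm]
  exact Finset.sum_congr rfl fun _ _ => Finset.sum_congr rfl fun _ _ =>
    Quaternion.re_mul_comm _ _

lemma mem_unitary_matrix_iff [DecidableEq ι] {G : Matrix ι ι ℍ[ℝ]} :
    G ∈ unitary (Matrix ι ι ℍ[ℝ]) ↔ Gᴴ * G = 1 ∧ G * Gᴴ = 1 := Iff.rfl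

lemma conjTranspose_mem_unitary [DecidableEq ι] {G : Matrix ι ι ℍ[ℝ]}
    (hG : G ∈ unitary (Matrix ι ι ℍ[ℝ])) : Gᴴ ∈ unitary (Matrix ι ι ℍ[ℝ]) :=
  Unitary.star_mem hG

lemma rankOneUpdate_mul_rankOneUpdate [DecidableEq ι] (w : Matrix ι Unit ℍ[ℝ]) (s t : ℍ[ℝ])
    (h : s + t + s * (wᴴ * w) () () * t = 0) : rankOneUpdate w s * rankOneUpdate w t = 1 := by
  set S : Matrix Unit Unit ℍ[ℝ] := Matrix.of fun _ _ => s with hS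
  set T : Matrix Unit Unit ℍ[ℝ] := Matrix.of fun _ _ => t with hT
  have h' : S + T + S * (wᴴ * w) * T = 0 := by
    ext1
    simpa [hS, hT, Matrix.mul_apply] using h
  calc rankOneUpdate w s * rankOneUpdate w t
      = 1 + w * (S + T + S * (wᴴ * w) * T) * wᴴ := by
        simp only [rankOneUpdate, ← hS, ← hT]
        simp only [Matrix.mul_add, Matrix.add_mul, Matrix.mul_one, Matrix.one_mul,
          Matrix.mul_assoc]
        abel
    _ = 1 := by simp [h']

lemma conjTranspose_mul_self_unit (w : Matrix ι Unit ℍ[ℝ]) :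
    (wᴴ * w) () () = ((∑ i, Quaternion.normSq (w i ()) : ℝ) : ℍ[ℝ]) := by
  simp only [Matrix.mul_apply, Matrix.conjTranspose_apply, Quaternion.star_mul_self]
  exact (map_sum (algebraMap ℝ ℍ[ℝ]) _ _).symm

/-- If multiplication by a unitary matrix never increases `Re tr X`, then all the values
`wᴴ X w` are nonnegative reals. The test matrices are the unitary matrices
`1 + w (p - 1) wᴴ / |w|²` with `|p| = 1`. -/
lemma quadForm_of_re_trace_le [DecidableEq ι] {X : Matrix ι ι ℍ[ℝ]}
    (hX : ∀ G ∈ unitary (Matrix ι ι ℍ[ℝ]), (G * X).trace.re ≤ X.trace.re)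
    (w : Matrix ι Unit ℍ[ℝ]) :
    0 ≤ ((wᴴ * X * w) () ()).re ∧
      (wᴴ * X * w) () () = ((((wᴴ * X * w) () ()).re : ℝ) : ℍ[ℝ]) := by
  set N : ℝ := ∑ i, Quaternion.normSq (w i ()) with hN
  rcases eq_or_ne N 0 with h0 | h0
  · have hw : w = 0 := by
      ext1 i j
      have := (Finset.sum_eq_zero_iff_of_nonneg fun _ _ => Quaternion.normSq_nonneg).mp h0 i
        (Finset.mem_univ i)
      simpa using this
    simp [hw]
  have hNpos : 0 < N :=
    lt_of_le_of_ne (Finset.sum_nonneg fun _ _ => Quaternion.normSq_nonneg) h0.symm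
  have unit_mul (p : ℍ[ℝ]) (hp : p * star p = 1) :
      rankOneUpdate w ((N⁻¹ : ℝ) * (p - 1)) * rankOneUpdate w ((N⁻¹ : ℝ) * (star p - 1)) = 1 := by
    apply rankOneUpdate_mul_rankOneUpdate
    have hc : ((N⁻¹ : ℝ) : ℍ[ℝ]) * (p - 1) * N = p - 1 := by
      rw [Quaternion.coe_commutes, mul_assoc, ← Quaternion.coe_mul, inv_mul_cancel₀ h0,
        Quaternion.coe_one, mul_one]
    rw [conjTranspose_mul_self_unit, ← hN, hc, ← mul_assoc (p - 1), ← Quaternion.coe_commutes,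
      mul_assoc, ← mul_add, ← mul_add]
    have : p - 1 + (star p - 1) + (p - 1) * (star p - 1) = 0 := by
      rw [sub_mul, mul_sub, hp]; noncomm_ring
    rw [this, mul_zero]
  apply Quaternion.eq_coe_of_forall_re_mul_le
  intro p hp
  have hp' : star p * star (star p) = 1 := by
    rw [star_star, Quaternion.star_mul_self, ← Quaternion.self_mul_star, hp]
  have hst (q : ℍ[ℝ]) : star ((N⁻¹ : ℝ) * (q - 1)) = ((N⁻¹ : ℝ) : ℍ[ℝ]) * (star q - 1) := by
    rw [star_mul, Quaternion.star_coe, star_sub, star_one, Quaternion.coe_commutes]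
  have hG : rankOneUpdate w ((N⁻¹ : ℝ) * (p - 1)) ∈ unitary (Matrix ι ι ℍ[ℝ]) := by
    rw [mem_unitary_matrix_iff, rankOneUpdate_conjTranspose, hst]
    refine ⟨?_, unit_mul p hp⟩
    simpa using unit_mul (star p) hp'
  have h1 := hX _ hG
  rw [rankOneUpdate, Matrix.add_mul, Matrix.one_mul, Matrix.trace_add, Quaternion.re_add,
    Matrix.mul_assoc, Matrix.mul_assoc, re_trace_mul_comm, Matrix.mul_assoc] at h1
  have h2 : ((Matrix.of fun _ _ => ((N⁻¹ : ℝ) : ℍ[ℝ]) * (p - 1) : Matrix Unit Unit ℍ[ℝ]) *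
      (wᴴ * X * w)).trace.re = N⁻¹ * ((p * (wᴴ * X * w) () ()).re - ((wᴴ * X * w) () ()).re) := by
    simp only [Matrix.trace, Matrix.diag_apply, Matrix.mul_apply (M := Matrix.of _),
      Finset.univ_unique, Finset.sum_singleton, Matrix.of_apply]
    rw [mul_assoc, Quaternion.coe_mul_eq_smul, Quaternion.re_smul, sub_mul, one_mul,
      Quaternion.re_sub]
    rfl
  rw [h2] at h1
  have h3 : N⁻¹ * ((p * (wᴴ * X * w) () ()).re - ((wᴴ * X * w) () ()).re) ≤ 0 := by linarith
  have := nonpos_of_mul_nonpos_right h3 (inv_pos.mpr hNpos)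
  linarith

lemma Quaternion.eq_zero_of_forall_mul_real {d : ℍ[ℝ]} (h : ∀ q, star (d * q) = d * q) :
    d = 0 := by
  have h1 := h 1
  -- `q = 1` shows that `d` is real, and `q = i` that its real part vanishes.
  obtain ⟨e, he, heI, heJ, heK⟩ : ∃ e : ℍ[ℝ], e.re = 0 ∧ e.imI = 1 ∧ e.imJ = 0 ∧ e.imK = 0 :=
    ⟨⟨0, 1, 0, 0⟩, rfl, rfl, rfl, rfl⟩
  have h2 := congrArg QuaternionAlgebra.imI (h e)
  simp only [mul_one, Quaternion.ext_iff, Quaternion.re_star, Quaternion.imI_star,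
    Quaternion.imJ_star, Quaternion.imK_star, Quaternion.imI_mul, he, heI, heJ, heK] at h1 h2
  ext <;> simp <;> linarith [h1.2.1, h1.2.2.1, h1.2.2.2]

/-- The critical point condition: if multiplication by a unitary matrix never increases
`Re tr X`, then `X` is Hermitian with nonnegative real diagonal. -/
lemma hermitian_of_re_trace_le [DecidableEq ι] {X : Matrix ι ι ℍ[ℝ]}
    (hX : ∀ G ∈ unitary (Matrix ι ι ℍ[ℝ]), (G * X).trace.re ≤ X.trace.re) :
    (∀ i j, X i j = star (X j i)) ∧ ∀ i, 0 ≤ (X i i).re := by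
  have hdiag (i : ι) : 0 ≤ (X i i).re ∧ X i i = (((X i i).re : ℝ) : ℍ[ℝ]) := by
    have := quadForm_of_re_trace_le hX (Matrix.of fun k _ => if k = i then 1 else 0)
    simpa [Matrix.mul_apply, apply_ite star] using this
  refine ⟨fun i j => ?_, fun i => (hdiag i).1⟩
  rcases eq_or_ne i j with rfl | hij
  · rw [(hdiag i).2, Quaternion.star_coe]
  rw [← sub_eq_zero]
  -- Polarization: `wᴴ X w` is real for `w = e_i + e_j q`, and so are the diagonal terms.
  apply Quaternion.eq_zero_of_forall_mul_real
  intro q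
  have h := (quadForm_of_re_trace_le hX
    (Matrix.of fun k _ => (if k = i then 1 else 0) + if k = j then q else 0)).2
  have h1 := congrArg star h
  rw [Quaternion.star_coe, ← h] at h1
  simp only [Matrix.mul_apply, Matrix.conjTranspose_apply, Matrix.of_apply, star_add,
    apply_ite star, star_one, star_zero, add_mul, mul_add, ite_mul, mul_ite, one_mul, mul_one,
    zero_mul, mul_zero, Finset.sum_add_distrib, Finset.sum_ite_eq',
    Finset.mem_univ, if_true, star_mul, star_star] at h1
  have hj : star (X j j) = X j j := by rw [(hdiag j).2, Quaternion.star_coe]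
  have hi : star (X i i) = X i i := by rw [(hdiag i).2, Quaternion.star_coe]
  rw [hi, hj] at h1
  simp only [star_mul, star_sub, star_star, sub_mul]
  simp only [mul_assoc] at h1
  have h2 := sub_eq_zero.mpr h1
  rw [← sub_eq_zero, ← h2]
  abel

end Trace

lemma Quaternion.coe_eq_zero {r : ℝ} : (r : ℍ[ℝ]) = 0 ↔ r = 0 :=
  Quaternion.coe_inj (y := 0)

/-! ### The singular value decomposition of a quaternion matrix -/

section SVD

variable {a b : ℕ}

lemma mul_rectDiag_apply {ι : Type*} (B : Matrix ι (Fin a) ℍ[ℝ]) (σ : ℕ → ℝ) (i : ι) (j : Fin b) :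
    (B * rectDiag a b σ) i j = if h : j.val < a then B i ⟨j, h⟩ * (σ j : ℍ[ℝ]) else 0 := by
  simp only [Matrix.mul_apply, rectDiag, Matrix.of_apply, mul_ite, mul_zero]
  split_ifs with h
  · rw [Finset.sum_eq_single ⟨j, h⟩]
    · simp
    · intro k _ hk
      exact if_neg fun h' => hk (Fin.ext h')
    · simp
  · exact Finset.sum_eq_zero fun k _ => if_neg fun h' => h (by omega)

lemma rectDiag_mul_apply {ι : Type*} (B : Matrix (Fin b) ι ℍ[ℝ]) (σ : ℕ → ℝ) (i : Fin a) (j : ι) :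
    (rectDiag a b σ * B) i j = if h : i.val < b then (σ i : ℍ[ℝ]) * B ⟨i, h⟩ j else 0 := by
  simp only [Matrix.mul_apply, rectDiag, Matrix.of_apply, ite_mul, zero_mul]
  split_ifs with h
  · rw [Finset.sum_eq_single ⟨i, h⟩]
    · simp
    · intro k _ hk
      exact if_neg fun h' => hk (Fin.ext h'.symm)
    · simp
  · exact Finset.sum_eq_zero fun k _ => if_neg fun h' => h (by omega)

lemma rectDiag_conjTranspose (σ : ℕ → ℝ) : (rectDiag a b σ)ᴴ = rectDiag b a σ := by
  ext1 i j
  simp only [rectDiag, Matrix.conjTranspose_apply, Matrix.of_apply]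
  by_cases h : i.val = j.val
  · rw [if_pos h, if_pos h.symm, Quaternion.star_coe, h]
  · rw [if_neg h, if_neg (Ne.symm h), star_zero]

/-- `Σ Σᵀ` is diagonal with entries `σ i ^ 2`; as `σ` vanishes after the `min a b` diagonal
positions, this holds for the rows beyond them too. -/
lemma rectDiag_mul_rectDiag {σ : ℕ → ℝ} (h0 : ∀ i, min a b ≤ i → σ i = 0) :
    rectDiag a b σ * rectDiag b a σ =
      Matrix.diagonal fun i : Fin a => ((σ i ^ 2 : ℝ) : ℍ[ℝ]) := by
  ext1 i j
  rw [mul_rectDiag_apply, Matrix.diagonal_apply, rectDiag]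
  simp only [Matrix.of_apply]
  by_cases hij : i = j
  · subst hij
    by_cases h : i.val < b
    · simp [h, sq]
    · simp [h, h0 i (by omega)]
  · have : i.val ≠ j.val := fun h => hij (Fin.ext h)
    simp [this, hij]

lemma re_trace_rectDiag_mul (B : QMatrix b a) (σ : ℕ → ℝ) :
    (rectDiag a b σ * B).trace.re =
      ∑ i : Fin a, if h : i.val < b then σ i * (B ⟨i, h⟩ i).re else 0 := by
  rw [Matrix.trace, Quaternion.re_sum]
  refine Finset.sum_congr rfl fun i _ => ?_
  rw [Matrix.diag_apply, rectDiag_mul_apply]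
  split_ifs with h
  · simp
  · rfl

lemma sum_normSq_row {U : QMatrix a a} (hU : U ∈ unitary (QMatrix a a)) (i : Fin a) :
    ∑ j, Quaternion.normSq (U i j) = 1 := by
  have := congrArg QuaternionAlgebra.re (congrFun (congrFun (mem_unitary_matrix_iff.mp hU).2 i) i)
  simpa [Matrix.mul_apply, Quaternion.self_mul_star, Quaternion.re_sum] using this

lemma sum_normSq_col {U : QMatrix a a} (hU : U ∈ unitary (QMatrix a a)) (j : Fin a) :
    ∑ i, Quaternion.normSq (U i j) = 1 := by
  have := congrArg QuaternionAlgebra.re (congrFun (congrFun (mem_unitary_matrix_iff.mp hU).1 j) j)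
  simpa [Matrix.mul_apply, Quaternion.star_mul_self, Quaternion.re_sum] using this

lemma isCompact_unitary_qmatrix : IsCompact (unitary (QMatrix a a) : Set (QMatrix a a)) := by
  have hK : IsCompact (Set.univ.pi fun _ : Fin a => Set.univ.pi fun _ : Fin a =>
      Metric.closedBall (0 : ℍ[ℝ]) 1) :=
    isCompact_univ_pi fun _ => isCompact_univ_pi fun _ => isCompact_closedBall _ _
  refine hK.of_isClosed_subset ?_ ?_
  · have : (unitary (QMatrix a a) : Set (QMatrix a a)) =
        {U | Uᴴ * U = 1} ∩ {U | U * Uᴴ = 1} := rfl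
    rw [this]
    exact (isClosed_eq (by fun_prop) continuous_const).inter
      (isClosed_eq (by fun_prop) continuous_const)
  · intro U hU i _ j _
    rw [mem_closedBall_zero_iff]
    have h2 := sum_normSq_row hU i
    simp only [Quaternion.normSq_eq_norm_mul_self] at h2
    have h3 := Finset.single_le_sum (f := fun j => ‖U i j‖ * ‖U i j‖)
      (fun _ _ => mul_self_nonneg _) (Finset.mem_univ j)
    have h4 : ‖U i j‖ * ‖U i j‖ ≤ 1 := h3.trans h2.le
    nlinarith [norm_nonneg (U i j)]

/-- If `B` maximizes `Re tr (C G B H)` over unitary `G` and `H`, where the diagonal of `C` is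
positive and strictly decreasing, then `B` is diagonal with nonnegative real entries. -/
lemma eq_zero_of_isMax {B : QMatrix a b} {c : ℕ → ℝ} (hc : StrictAnti c) (hc0 : ∀ i, 0 < c i)
    (hL : ∀ G ∈ unitary (QMatrix a a),
      (rectDiag b a c * (G * B)).trace.re ≤ (rectDiag b a c * B).trace.re)
    (hR : ∀ G ∈ unitary (QMatrix b b),
      (rectDiag b a c * (B * G)).trace.re ≤ (rectDiag b a c * B).trace.re) :
    (∀ (i : Fin a) (j : Fin b), i.val ≠ j.val → B i j = 0) ∧
      ∀ (i : Fin a) (j : Fin b), i.val = j.val → 0 ≤ (B i j).re ∧ B i j = ((B i j).re : ℍ[ℝ]) := by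
  obtain ⟨h1, h1'⟩ := hermitian_of_re_trace_le (X := B * rectDiag b a c) fun G hG => by
    rw [← Matrix.mul_assoc, re_trace_mul_comm, re_trace_mul_comm B]
    exact hL G hG
  obtain ⟨h2, -⟩ := hermitian_of_re_trace_le (X := rectDiag b a c * B) fun G hG => by
    rw [re_trace_mul_comm, Matrix.mul_assoc]
    exact hR G hG
  have hcne (i : ℕ) : (c i : ℍ[ℝ]) ≠ 0 := by
    rw [Ne, Quaternion.coe_eq_zero]
    exact (hc0 i).ne'
  constructor
  · intro i j hij
    by_cases hja : j.val < a
    · by_cases hib : i.val < b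
      · have e1 := h1 i ⟨j, hja⟩
        have e2 := h2 ⟨i, hib⟩ j
        simp only [mul_rectDiag_apply, rectDiag_mul_apply, hib, hja, Fin.is_lt, dite_true, star_mul,
          Quaternion.star_coe, Fin.eta] at e1 e2
        -- With `y = star (B j i)`: `B i j * c j = c i * y` and `c i * B i j = y * c j`.
        have e3 : ((c i ^ 2 - c j ^ 2 : ℝ) : ℍ[ℝ]) * B i j = 0 := by
          have e4 : (c i : ℍ[ℝ]) * (c i * B i j) = c j * (c j * B i j) := by
            generalize star (B ⟨j, hja⟩ ⟨i, hib⟩) = y at e1 e2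
            rw [e2, ← mul_assoc, ← e1, Quaternion.coe_commutes (c j) (c j * B i j),
              Quaternion.coe_commutes (c j) (B i j)]
          rw [Quaternion.coe_sub, Quaternion.coe_pow, Quaternion.coe_pow, sub_mul, sq, sq,
            mul_assoc, mul_assoc, e4, sub_self]
        rcases mul_eq_zero.mp e3 with h | h
        · rw [Quaternion.coe_eq_zero] at h
          have : c i = c j := by
            have hi := hc0 i
            have hj := hc0 j
            exact (pow_left_inj₀ hi.le hj.le two_ne_zero).mp (by linarith)
          exact absurd (hc.injective this) hij
        · exact h
      · have e1 := h1 i ⟨j, hja⟩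
        simp only [mul_rectDiag_apply, hib, Fin.is_lt, dite_true, dite_false, star_zero, Fin.eta] at e1
        exact (mul_eq_zero.mp e1).resolve_right (hcne _)
    · have hib : i.val < b := by omega
      have e2 := h2 ⟨i, hib⟩ j
      simp only [rectDiag_mul_apply, hja, Fin.is_lt, dite_true, dite_false, star_zero, Fin.eta] at e2
      exact (mul_eq_zero.mp e2).resolve_left (hcne _)
  · intro i j hij
    have hib : i.val < b := hij ▸ j.isLt
    obtain rfl : j = ⟨i, hib⟩ := Fin.ext hij.symm
    have e1 := h1 i i
    have e1' := h1' i
    simp only [mul_rectDiag_apply, hib, dite_true, star_mul, Quaternion.star_coe] at e1 e1'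
    have e2 : 0 ≤ (B i ⟨i, hib⟩).re * c i := by simpa using e1'
    refine ⟨nonneg_of_mul_nonneg_left e2 (hc0 i), ?_⟩
    rw [← Quaternion.coe_commutes] at e1
    exact Quaternion.star_eq_self.mp (mul_left_cancel₀ (hcne i) e1).symm

lemma one_submatrix_mem_unitary (e : Equiv.Perm (Fin a)) :
    (1 : QMatrix a a).submatrix e id ∈ unitary (QMatrix a a) := by
  rw [mem_unitary_matrix_iff]
  rw [Matrix.conjTranspose_submatrix, Matrix.conjTranspose_one]
  constructor
  · rw [Matrix.submatrix_mul_equiv, Matrix.one_mul, Matrix.submatrix_id_id]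
  · rw [← Matrix.submatrix_mul _ _ _ _ _ Function.bijective_id, Matrix.one_mul,
      Matrix.submatrix_one_equiv]

/-- If `B` maximizes `Re tr (C G B H)` over unitary `G` and `H`, where the diagonal of `C` is
strictly decreasing, then the real parts of the diagonal of `B` are in descending order: otherwise
exchanging two indices would increase the trace. -/
lemma diag_antitone_of_isMax {B : QMatrix a b} {c : ℕ → ℝ} (hc : StrictAnti c)
    (hLR : ∀ G ∈ unitary (QMatrix a a), ∀ H ∈ unitary (QMatrix b b),
      (rectDiag b a c * (G * B * H)).trace.re ≤ (rectDiag b a c * B).trace.re)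
    {i j : ℕ} (hij : i < j) (hja : j < a) (hjb : j < b) :
    (B ⟨j, hja⟩ ⟨j, hjb⟩).re ≤ (B ⟨i, hij.trans hja⟩ ⟨i, hij.trans hjb⟩).re := by
  set ia : Fin a := ⟨i, hij.trans hja⟩
  set ja : Fin a := ⟨j, hja⟩
  set ib : Fin b := ⟨i, hij.trans hjb⟩
  set jb : Fin b := ⟨j, hjb⟩
  have h := hLR _ (one_submatrix_mem_unitary (Equiv.swap ia ja)) _
    (one_submatrix_mem_unitary (Equiv.swap ib jb))
  have hB : (1 : QMatrix a a).submatrix (Equiv.swap ia ja) id * B *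
      (1 : QMatrix b b).submatrix (Equiv.swap ib jb) id =
      B.submatrix (Equiv.swap ia ja) (Equiv.swap ib jb) := by
    ext1 k l
    have hl (x : Fin b) : x = Equiv.swap ib jb l ↔ Equiv.swap ib jb x = l := by
      rw [Equiv.swap_apply_eq_iff]
    simp [Matrix.mul_apply, Matrix.one_apply, ← hl]
  -- The two traces differ only in the terms of `i` and `j`.
  rw [hB, re_trace_rectDiag_mul, re_trace_rectDiag_mul, ← sub_nonpos,
    ← Finset.sum_sub_distrib, Finset.sum_eq_add ib jb] at h
  · have h1 : ib.val < a := hij.trans hja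
    have h2 : jb.val < a := hja
    rw [dif_pos h1, dif_pos h1, dif_pos h2, dif_pos h2] at h
    simp only [Matrix.submatrix_apply, Equiv.swap_apply_left, Equiv.swap_apply_right] at h
    change c i * (B (Equiv.swap ia ja ia) jb).re - c i * (B ia ib).re +
      (c j * (B (Equiv.swap ia ja ja) ib).re - c j * (B ja jb).re) ≤ 0 at h
    rw [Equiv.swap_apply_left, Equiv.swap_apply_right] at h
    have h3 : (c i - c j) * ((B ja jb).re - (B ia ib).re) ≤ 0 := by linarith
    have := nonpos_of_mul_nonpos_right h3 (sub_pos.mpr (hc hij))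
    linarith
  · intro h'
    exact hij.ne (Fin.mk.inj h')
  · intro k _ ⟨hk1, hk2⟩
    split_ifs with hka
    · have e1 : Equiv.swap ia ja ⟨k, hka⟩ = ⟨k, hka⟩ :=
        Equiv.swap_apply_of_ne_of_ne (fun h' => hk1 (Fin.ext (Fin.mk.inj h')))
          (fun h' => hk2 (Fin.ext (Fin.mk.inj h')))
      rw [Matrix.submatrix_apply, e1, Equiv.swap_apply_of_ne_of_ne hk1 hk2, sub_self]
    · simp
  · simp
  · simp

/-- Every quaternion matrix has a singular value decomposition. -/
theorem exists_isQSVD (A : QMatrix a b) : ∃ U σ V, IsQSVD A U σ V := by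
  set c : ℕ → ℝ := fun i => ((i : ℝ) + 1)⁻¹ with hcdef
  have hc0 (i : ℕ) : 0 < c i := by positivity
  have hc : StrictAnti c := fun i j hij => by
    simp only [hcdef]
    gcongr
  obtain ⟨⟨U, V⟩, ⟨hU, hV⟩, hmax⟩ :=
    ((isCompact_unitary_qmatrix (a := a)).prod (isCompact_unitary_qmatrix (a := b))).exists_isMaxOn
      ⟨(1, 1), one_mem _, one_mem _⟩
      (f := fun x => (rectDiag b a c * (x.1ᴴ * A * x.2)).trace.re)
      (Continuous.continuousOn (Quaternion.continuous_re.comp (by fun_prop)))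
  set B : QMatrix a b := Uᴴ * A * V with hB
  have hLR : ∀ G ∈ unitary (QMatrix a a), ∀ H ∈ unitary (QMatrix b b),
      (rectDiag b a c * (G * B * H)).trace.re ≤ (rectDiag b a c * B).trace.re := by
    intro G hG H hH
    have := hmax (show (U * Gᴴ, V * H) ∈ _ from
      ⟨mul_mem hU (conjTranspose_mem_unitary hG), mul_mem hV hH⟩)
    simpa [hB, Matrix.conjTranspose_mul, Matrix.mul_assoc] using this
  obtain ⟨hoff, hdiag⟩ := eq_zero_of_isMax (B := B) hc hc0
    (fun G hG => by simpa using hLR G hG 1 (one_mem _))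
    (fun H hH => by simpa using hLR 1 (one_mem _) H hH)
  set σ : ℕ → ℝ := fun i =>
    if h : i < a ∧ i < b then (B ⟨i, h.1⟩ ⟨i, h.2⟩).re else 0 with hσ
  have hσ0 (i : ℕ) : 0 ≤ σ i := by
    simp only [hσ]
    split_ifs with h
    · exact (hdiag _ _ rfl).1
    · exact le_rfl
  refine ⟨U, σ, V, hU, hV, ?_, hσ0, ?_, ?_⟩
  · intro i j hij
    rcases hij.eq_or_lt with rfl | hij
    · exact le_rfl
    by_cases h : j < a ∧ j < b
    · have hi : i < a ∧ i < b := ⟨hij.trans h.1, hij.trans h.2⟩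
      simp only [hσ, dif_pos h, dif_pos hi]
      exact diag_antitone_of_isMax hc hLR hij h.1 h.2
    · have : σ j = 0 := dif_neg h
      rw [this]
      exact hσ0 i
  · intro i hi
    exact dif_neg (by omega)
  · have hBσ : B = rectDiag a b σ := by
      ext1 i j
      rw [rectDiag, Matrix.of_apply]
      split_ifs with h
      · have hi : i.val < a ∧ i.val < b := ⟨i.isLt, h ▸ j.isLt⟩
        obtain rfl : j = ⟨i, hi.2⟩ := Fin.ext h.symm
        simp only [hσ, dif_pos hi]
        exact (hdiag _ _ rfl).2
      · exact hoff i j h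
    rw [← hBσ, hB]
    simp only [← Matrix.mul_assoc]
    rw [(mem_unitary_matrix_iff.mp hU).2, Matrix.one_mul, Matrix.mul_assoc,
      (mem_unitary_matrix_iff.mp hV).2, Matrix.mul_one]

/-- Unitarily similar real diagonal matrices have the same entries with the same multiplicities:
if `H` intertwines them, then `|H i j|²` is a doubly stochastic matrix supported where the entries
agree. -/
lemma sum_eq_of_intertwine {n : ℕ} {d d' : Fin n → ℝ} {H : QMatrix n n}
    (hH : H ∈ unitary (QMatrix n n))
    (h : Matrix.diagonal (fun i => (d i : ℍ[ℝ])) * H = H * Matrix.diagonal fun i => (d' i : ℍ[ℝ]))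
    (f : ℝ → ℝ) : ∑ i, f (d i) = ∑ j, f (d' j) := by
  have supp (i j : Fin n) :
      f (d i) * Quaternion.normSq (H i j) = f (d' j) * Quaternion.normSq (H i j) := by
    have h1 := congrFun (congrFun h i) j
    rw [Matrix.diagonal_mul, Matrix.mul_diagonal, ← Quaternion.coe_commutes, ← sub_eq_zero,
      ← sub_mul, ← Quaternion.coe_sub] at h1
    rcases mul_eq_zero.mp h1 with h2 | h2
    · rw [Quaternion.coe_eq_zero, sub_eq_zero] at h2
      rw [h2]
    · simp [h2]
  calc ∑ i, f (d i) = ∑ i, ∑ j, f (d i) * Quaternion.normSq (H i j) := by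
        simp [← Finset.mul_sum, sum_normSq_row hH]
    _ = ∑ j, ∑ i, f (d' j) * Quaternion.normSq (H i j) := by
        rw [Finset.sum_comm]
        simp only [supp]
    _ = ∑ j, f (d' j) := by simp [← Finset.mul_sum, sum_normSq_col hH]

lemma antitone_le_of_sum_eq {n : ℕ} {d d' : Fin n → ℝ} (hd : Antitone d) (hd' : Antitone d')
    (h : ∀ f : ℝ → ℝ, ∑ i, f (d i) = ∑ i, f (d' i)) (k : Fin n) : d' k ≤ d k := by
  by_contra! hlt
  -- Count the entries above the level `d k`.
  have h1 := h fun x => if d k < x then 1 else 0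
  simp only [Finset.sum_boole, Nat.cast_inj] at h1
  have h2 : (Finset.univ.filter fun i => d k < d i) ⊂ Finset.univ.filter fun i => d k < d' i := by
    rw [Finset.ssubset_iff_of_subset]
    · exact ⟨k, by simpa using hlt, by simp⟩
    · intro i hi
      simp only [Finset.mem_filter, Finset.mem_univ, true_and] at hi ⊢
      have hik : i ≤ k := le_of_not_ge fun hki => absurd (hd hki) (not_le.mpr hi)
      exact hlt.trans_le (hd' hik)
  exact (Finset.card_lt_card h2).ne h1

lemma IsQSVD.conjTranspose_mul_self {A : QMatrix a b} {U : QMatrix a a} {σ : ℕ → ℝ}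
    {V : QMatrix b b} (h : IsQSVD A U σ V) :
    (A * V)ᴴ * (A * V) = Matrix.diagonal fun i : Fin b => ((σ i ^ 2 : ℝ) : ℍ[ℝ]) := by
  have e : A * V = U * rectDiag a b σ := by
    rw [h.eq, Matrix.mul_assoc, (mem_unitary_matrix_iff.mp h.unitary_right).1, Matrix.mul_one]
  rw [e, Matrix.conjTranspose_mul, Matrix.mul_assoc, ← Matrix.mul_assoc Uᴴ,
    (mem_unitary_matrix_iff.mp h.unitary_left).1, Matrix.one_mul, rectDiag_conjTranspose,
    rectDiag_mul_rectDiag fun i hi => h.eq_zero i (by omega)]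

lemma IsQSVD.mul_conjTranspose_self {A : QMatrix a b} {U : QMatrix a a} {σ : ℕ → ℝ}
    {V : QMatrix b b} (h : IsQSVD A U σ V) :
    (Uᴴ * A) * (Uᴴ * A)ᴴ = Matrix.diagonal fun i : Fin a => ((σ i ^ 2 : ℝ) : ℍ[ℝ]) := by
  have e : Uᴴ * A = rectDiag a b σ * Vᴴ := by
    rw [h.eq, ← Matrix.mul_assoc, ← Matrix.mul_assoc, (mem_unitary_matrix_iff.mp h.unitary_left).1,
      Matrix.one_mul]
  rw [e, Matrix.conjTranspose_mul, Matrix.conjTranspose_conjTranspose, Matrix.mul_assoc,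
    ← Matrix.mul_assoc Vᴴ, (mem_unitary_matrix_iff.mp h.unitary_right).1, Matrix.one_mul,
    rectDiag_conjTranspose, rectDiag_mul_rectDiag h.eq_zero]

/-- The singular values of a quaternion matrix are unique. -/
theorem IsQSVD.singularValues_unique {A : QMatrix a b} {U U' : QMatrix a a} {σ σ' : ℕ → ℝ}
    {V V' : QMatrix b b} (h : IsQSVD A U σ V) (h' : IsQSVD A U' σ' V') : σ = σ' := by
  have sum_eq : ∀ f : ℝ → ℝ,
      ∑ i : Fin b, f (σ i ^ 2) = ∑ i : Fin b, f (σ' i ^ 2) := by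
    refine sum_eq_of_intertwine (H := Vᴴ * V')
      (mul_mem (conjTranspose_mem_unitary h.unitary_right) h'.unitary_right) ?_
    -- Both sides are `Vᴴ Aᴴ A V'`.
    rw [← h.conjTranspose_mul_self, ← h'.conjTranspose_mul_self]
    simp only [Matrix.conjTranspose_mul, ← Matrix.mul_assoc]
    rw [Matrix.mul_assoc _ V Vᴴ, (mem_unitary_matrix_iff.mp h.unitary_right).2, Matrix.mul_one,
      Matrix.mul_assoc _ V' V'ᴴ, (mem_unitary_matrix_iff.mp h'.unitary_right).2, Matrix.mul_one]
  have anti {τ : ℕ → ℝ} (hτ : Antitone τ) (hτ0 : ∀ i, 0 ≤ τ i) :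
      Antitone fun i : Fin b => τ i ^ 2 :=
    fun i j hij => pow_le_pow_left₀ (hτ0 _) (hτ hij) 2
  funext k
  by_cases hk : k < b
  · have h1 := antitone_le_of_sum_eq (anti h.antitone h.nonneg) (anti h'.antitone h'.nonneg)
      sum_eq ⟨k, hk⟩
    have h2 := antitone_le_of_sum_eq (anti h'.antitone h'.nonneg) (anti h.antitone h.nonneg)
      (fun f => (sum_eq f).symm) ⟨k, hk⟩
    exact (pow_left_inj₀ (h.nonneg k) (h'.nonneg k) two_ne_zero).mp (le_antisymm h2 h1)
  · rw [h.eq_zero k (by omega), h'.eq_zero k (by omega)]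

end SVD

/-! ### Mode products, slices and unfoldings -/

namespace QTensor

section Products

variable {N : ℕ} {I : Fin N → ℕ}

lemma re_innerL_eq_re_innerR (A B : QTensor I) : (innerL A B).re = (innerR A B).re := by
  rw [innerL, innerR, Quaternion.re_sum, Quaternion.re_sum]
  refine Finset.sum_congr rfl fun i _ => ?_
  simp only [Quaternion.re_mul, Quaternion.re_star, Quaternion.imI_star, Quaternion.imJ_star,
    Quaternion.imK_star]
  ring

lemma frobNorm_eq_of_re_innerL {T : QTensor I} {r : ℝ} (hr : 0 ≤ r)
    (h : (innerL T T).re = r ^ 2) : frobNorm T = r := by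
  rw [frobNorm, h, Real.sqrt_sq hr]

/-- Exchange of a summation index with the `k`-th index of a tensor. -/
lemma sum_sum_update (k : Fin N) (f : (∀ l, Fin (I l)) → Fin (I k) → ℍ[ℝ]) :
    ∑ i, ∑ r, f i r = ∑ i, ∑ r, f (Function.update i k r) (i k) := by
  rw [← Fintype.sum_prod_type', ← Fintype.sum_prod_type']
  refine Fintype.sum_bijective (fun x => (Function.update x.1 k x.2, x.1 k))
    (Function.Involutive.bijective fun x => by simp) _ _ fun x => by simp

lemma innerR_leftProd (k : Fin N) (U : QMatrix (I k) (I k)) (A B : QTensor I) :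
    innerR (leftProd k U A) B = innerR A (leftProd k Uᴴ B) := by
  simp only [innerR, leftProd, star_sum, Finset.sum_mul, Finset.mul_sum, star_mul]
  rw [sum_sum_update k]
  simp [mul_assoc]

lemma innerL_rightProd (k : Fin N) (V : QMatrix (I k) (I k)) (A B : QTensor I) :
    innerL (rightProd k A V) B = innerL A (rightProd k B Vᴴ) := by
  simp only [innerL, rightProd, star_sum, Finset.sum_mul, Finset.mul_sum, star_mul]
  rw [sum_sum_update k]
  simp [mul_assoc]

lemma leftProd_leftProd (k : Fin N) (U V : QMatrix (I k) (I k)) (T : QTensor I) :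
    leftProd k U (leftProd k V T) = leftProd k (U * V) T := by
  ext1 i
  simp only [leftProd, Finset.mul_sum, Matrix.mul_apply, Finset.sum_mul, Function.update_self,
    Function.update_idem, mul_assoc]
  exact Finset.sum_comm

lemma rightProd_rightProd (k : Fin N) (U V : QMatrix (I k) (I k)) (T : QTensor I) :
    rightProd k (rightProd k T U) V = rightProd k T (U * V) := by
  ext1 i
  simp only [rightProd, Finset.mul_sum, Matrix.mul_apply, Finset.sum_mul, Function.update_self,
    Function.update_idem, mul_assoc]
  exact Finset.sum_comm

@[simp] lemma leftProd_one (k : Fin N) (T : QTensor I) : leftProd k 1 T = T := by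
  ext1 i
  simp [leftProd, Matrix.one_apply]

@[simp] lemma rightProd_one (k : Fin N) (T : QTensor I) : rightProd k T 1 = T := by
  ext1 i
  simp [rightProd, Matrix.one_apply]

lemma innerR_leftProd_leftProd {k : Fin N} {U : QMatrix (I k) (I k)}
    (hU : U ∈ unitary (QMatrix (I k) (I k))) (A B : QTensor I) :
    innerR (leftProd k U A) (leftProd k U B) = innerR A B := by
  rw [innerR_leftProd, leftProd_leftProd, (mem_unitary_matrix_iff.mp hU).1, leftProd_one]

lemma innerL_rightProd_rightProd {k : Fin N} {V : QMatrix (I k) (I k)}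
    (hV : V ∈ unitary (QMatrix (I k) (I k))) (A B : QTensor I) :
    innerL (rightProd k A V) (rightProd k B V) = innerL A B := by
  rw [innerL_rightProd, rightProd_rightProd, (mem_unitary_matrix_iff.mp hV).2, rightProd_one]

lemma leftProd_rightProd {k l : Fin N} (h : k ≠ l) (U : QMatrix (I k) (I k))
    (V : QMatrix (I l) (I l)) (T : QTensor I) :
    leftProd k U (rightProd l T V) = rightProd l (leftProd k U T) V := by
  ext1 i
  simp only [rightProd, leftProd, Finset.mul_sum, Finset.sum_mul,
    Function.update_of_ne h, Function.update_of_ne h.symm, mul_assoc]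
  rw [Finset.sum_comm]
  simp only [Function.update_comm h]

end Products

section Slices

variable {n : ℕ} {I : Fin (n + 1) → ℕ}

lemma subtensor_leftProd (p : Fin (n + 1)) (l : Fin n)
    (U : QMatrix (I (p.succAbove l)) (I (p.succAbove l))) (T : QTensor I) (α : Fin (I p)) :
    subtensor (leftProd (p.succAbove l) U T) p α =
      leftProd (I := fun l => I (p.succAbove l)) l U (subtensor T p α) := by
  ext1 j
  simp [subtensor, leftProd, Fin.insertNth_update]

lemma subtensor_rightProd (p : Fin (n + 1)) (l : Fin n)
    (V : QMatrix (I (p.succAbove l)) (I (p.succAbove l))) (T : QTensor I) (α : Fin (I p)) :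
    subtensor (rightProd (p.succAbove l) T V) p α =
      rightProd (I := fun l => I (p.succAbove l)) l (subtensor T p α) V := by
  ext1 j
  simp [subtensor, rightProd, Fin.insertNth_update]

/-- A unitary left product in another mode preserves the right inner products of the slices. -/
lemma innerR_subtensor_leftProd {p k : Fin (n + 1)} (h : k ≠ p) {U : QMatrix (I k) (I k)}
    (hU : U ∈ unitary (QMatrix (I k) (I k))) (T : QTensor I) (α β : Fin (I p)) :
    innerR (subtensor (leftProd k U T) p α) (subtensor (leftProd k U T) p β) =
      innerR (subtensor T p α) (subtensor T p β) := by
  obtain ⟨l, rfl⟩ := Fin.exists_succAbove_eq h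
  rw [subtensor_leftProd, subtensor_leftProd,
    innerR_leftProd_leftProd (I := fun l => I (p.succAbove l)) hU]

/-- A unitary right product in another mode preserves the left inner products of the slices. -/
lemma innerL_subtensor_rightProd {p k : Fin (n + 1)} (h : k ≠ p) {V : QMatrix (I k) (I k)}
    (hV : V ∈ unitary (QMatrix (I k) (I k))) (T : QTensor I) (α β : Fin (I p)) :
    innerL (subtensor (rightProd k T V) p α) (subtensor (rightProd k T V) p β) =
      innerL (subtensor T p α) (subtensor T p β) := by
  obtain ⟨l, rfl⟩ := Fin.exists_succAbove_eq h
  rw [subtensor_rightProd, subtensor_rightProd,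
    innerL_rightProd_rightProd (I := fun l => I (p.succAbove l)) hV]

lemma innerL_subtensor (T : QTensor I) (p : Fin (n + 1)) (α β : Fin (I p)) :
    innerL (subtensor T p α) (subtensor T p β) = (unfoldL p T * (unfoldL p T)ᴴ) α β := by
  simp only [innerL, subtensor, Matrix.mul_apply, Matrix.conjTranspose_apply, unfoldL,
    Matrix.of_apply]
  exact (Equiv.sum_comp finPiFinEquiv.symm
    fun j => T (p.insertNth α j) * star (T (p.insertNth β j))).symm

lemma innerR_subtensor (T : QTensor I) (p : Fin (n + 1)) (α β : Fin (I p)) :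
    innerR (subtensor T p α) (subtensor T p β) = ((unfoldR p T)ᴴ * unfoldR p T) α β := by
  simp only [innerR, subtensor, Matrix.mul_apply, Matrix.conjTranspose_apply, unfoldR,
    Matrix.of_apply]
  exact (Equiv.sum_comp finPiFinEquiv.symm
    fun j => star (T (p.insertNth α j)) * T (p.insertNth β j)).symm

lemma unfoldL_leftProd (k : Fin (n + 1)) (U : QMatrix (I k) (I k)) (T : QTensor I) :
    unfoldL k (leftProd k U T) = U * unfoldL k T := by
  ext1 a c
  simp [unfoldL, leftProd, Matrix.mul_apply]

lemma unfoldR_rightProd (k : Fin (n + 1)) (V : QMatrix (I k) (I k)) (T : QTensor I) :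
    unfoldR k (rightProd k T V) = unfoldR k T * V := by
  ext1 a c
  simp [unfoldR, rightProd, Matrix.mul_apply]

end Slices

end QTensor

/-! ### The factors and the core tensor -/

namespace TSQHOSVD

variable {n m : ℕ} {I : Fin (n + 1) → ℕ} (hN : n + 1 = 2 * m)

lemma leftMode_injective : Function.Injective (leftMode hN) := fun j k h =>
  Fin.ext (by simpa [leftMode] using h)

lemma rightMode_injective : Function.Injective (rightMode hN) :=
  Fin.rev_injective.comp (leftMode_injective hN)

lemma leftMode_ne_rightMode (j k : Fin m) : leftMode hN j ≠ rightMode hN k := by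
  intro h
  have := congrArg Fin.val h
  simp only [leftMode, rightMode, Fin.val_rev] at this
  omega

lemma exists_eq_leftMode_or_rightMode (p : Fin (n + 1)) :
    ∃ k, p = leftMode hN k ∨ p = rightMode hN k := by
  by_cases hp : p.val < m
  · exact ⟨⟨p, hp⟩, Or.inl rfl⟩
  · refine ⟨⟨n - p, by omega⟩, Or.inr (Fin.ext ?_)⟩
    simp only [leftMode, rightMode, Fin.val_rev]
    omega

lemma leftProd_rightProds (k : Fin m) (A : QMatrix (I (leftMode hN k)) (I (leftMode hN k)))
    (V : RightFactors hN I) (ks : List (Fin m)) (T : QTensor I) :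
    leftProd (leftMode hN k) A (rightProds hN T V ks) =
      rightProds hN (leftProd (leftMode hN k) A T) V ks := by
  induction ks generalizing T with
  | nil => rfl
  | cons j ks ih =>
    exact (ih _).trans (by rw [leftProd_rightProd (leftMode_ne_rightMode hN k j)]; rfl)

lemma leftProds_rightProds (U : LeftFactors hN I) (V : RightFactors hN I) (js ks : List (Fin m))
    (T : QTensor I) :
    leftProds hN U js (rightProds hN T V ks) = rightProds hN (leftProds hN U js T) V ks := by
  induction js with
  | nil => rfl
  | cons j js ih =>
    change leftProd _ _ (leftProds hN U js _) = _
    rw [ih, leftProd_rightProds]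
    rfl

lemma leftProds_append (U : LeftFactors hN I) (js ks : List (Fin m)) (T : QTensor I) :
    leftProds hN U (js ++ ks) T = leftProds hN U js (leftProds hN U ks T) :=
  List.foldr_append

lemma rightProds_append (V : RightFactors hN I) (js ks : List (Fin m)) (T : QTensor I) :
    rightProds hN T V (js ++ ks) = rightProds hN (rightProds hN T V js) V ks :=
  List.foldl_append

lemma partialTensor_of_le (U : LeftFactors hN I) (V : RightFactors hN I) (T : QTensor I) {s : ℕ}
    (hs : m ≤ s) : partialTensor hN U V T s = T := by
  have : (List.finRange m).drop s = [] := List.drop_eq_nil_of_le (by simpa using hs)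
  rw [partialTensor, this]
  rfl

/-- The partially multiplied tensors satisfy `T_k = U_kᴴ ×ᴸ T_{k+1} ×ᴿ V_k`. -/
lemma partialTensor_eq (U : LeftFactors hN I) (V : RightFactors hN I) (T : QTensor I)
    (k : Fin m) :
    partialTensor hN U V T k =
      rightProd (rightMode hN k)
        (leftProd (leftMode hN k) (U k)ᴴ (partialTensor hN U V T (k + 1))) (V k) := by
  have h : (List.finRange m).drop k = k :: (List.finRange m).drop (k + 1) := by
    rw [List.drop_eq_getElem_cons (by simp)]
    simp
  rw [partialTensor, partialTensor, h, List.reverse_cons, rightProds_append,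
    leftProd_rightProds]
  rfl

/-- `partialTensor` at `s` depends only on the factors with number at least `s`. -/
lemma partialTensor_congr {U U' : LeftFactors hN I} {V V' : RightFactors hN I} (T : QTensor I)
    {s : ℕ} (hU : ∀ k : Fin m, s ≤ k → U k = U' k) (hV : ∀ k : Fin m, s ≤ k → V k = V' k) :
    partialTensor hN U V T s = partialTensor hN U' V' T s := by
  by_cases hs : s < m
  · have ih := partialTensor_congr (s := s + 1) T (fun k hk => hU k (by omega))
      (fun k hk => hV k (by omega))
    rw [partialTensor_eq hN U V T ⟨s, hs⟩, partialTensor_eq hN U' V' T ⟨s, hs⟩, ih,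
      hU ⟨s, hs⟩ le_rfl, hV ⟨s, hs⟩ le_rfl]
  · rw [partialTensor_of_le hN _ _ _ (by omega), partialTensor_of_le hN _ _ _ (by omega)]
termination_by m - s

/-- The factors are chosen from the last pair to the first. -/
lemma exists_isFactors (T : QTensor I) :
    ∃ (U : LeftFactors hN I) (V : RightFactors hN I), IsFactors hN T U V := by
  have key (r : ℕ) : ∃ (U : LeftFactors hN I) (V : RightFactors hN I), ∀ k : Fin m, m ≤ k + r →
      (∃ σ W, IsQSVD (leftMatrix hN U V T k) (U k) σ W) ∧
        ∃ W σ, IsQSVD (rightMatrix hN U V T k) W σ (V k) := by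
    induction r with
    | zero => exact ⟨fun _ => 1, fun _ => 1, fun k hk => absurd k.isLt (by omega)⟩
    | succ r ih =>
      obtain ⟨U, V, h⟩ := ih
      by_cases hr : r < m
      · let s : Fin m := ⟨m - (r + 1), by omega⟩
        obtain ⟨A, σ, W, hA⟩ := exists_isQSVD (leftMatrix hN U V T s)
        obtain ⟨W', σ', B, hB⟩ := exists_isQSVD (rightMatrix hN U V T s)
        refine ⟨Function.update U s A, Function.update V s B, fun k hk => ?_⟩
        have hsk : s.val ≤ k := by simp only [s]; omega
        have hP : partialTensor hN (Function.update U s A) (Function.update V s B) T (k + 1) =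
            partialTensor hN U V T (k + 1) := by
          refine partialTensor_congr hN T (fun j hj => ?_) fun j hj => ?_ <;>
            exact Function.update_of_ne (Fin.ne_of_gt (Fin.lt_def.mpr (by omega))) _ _
        rw [leftMatrix, rightMatrix, hP]
        rcases eq_or_ne k s with rfl | hks
        · rw [Function.update_self, Function.update_self]
          exact ⟨⟨σ, W, hA⟩, W', σ', hB⟩
        · rw [Function.update_of_ne hks, Function.update_of_ne hks]
          have : s.val ≠ k.val := fun h => hks (Fin.ext h.symm)
          exact h k (by simp only [s] at this hsk; omega)
      · exact ⟨U, V, fun k _ => h k (by omega)⟩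
  obtain ⟨U, V, h⟩ := key m
  exact ⟨U, V, fun k => (h k (by omega)).1, fun k => (h k (by omega)).2⟩

section Properties

variable {T : QTensor I} {U : LeftFactors hN I} {V : RightFactors hN I}

lemma leftProds_reverse_leftProds (hU : ∀ k, U k ∈ unitary (QMatrix _ _)) (ks : List (Fin m))
    (T : QTensor I) :
    leftProds hN U ks.reverse (leftProds hN (fun k => (U k)ᴴ) ks T) = T := by
  induction ks with
  | nil => rfl
  | cons k ks ih =>
    rw [List.reverse_cons, leftProds_append]
    change leftProds hN U _ (leftProd _ (U k) (leftProd _ (U k)ᴴ _)) = T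
    rw [leftProd_leftProd, (mem_unitary_matrix_iff.mp (hU k)).2, leftProd_one]
    exact ih

lemma rightProds_rightProds_reverse (hV : ∀ k, V k ∈ unitary (QMatrix _ _)) (ks : List (Fin m))
    (T : QTensor I) :
    rightProds hN (rightProds hN T V ks.reverse) (fun k => (V k)ᴴ) ks = T := by
  induction ks with
  | nil => rfl
  | cons k ks ih =>
    rw [List.reverse_cons, rightProds_append]
    change rightProds hN (rightProd _ (rightProd _ _ (V k)) (V k)ᴴ) _ ks = T
    rw [rightProd_rightProd, (mem_unitary_matrix_iff.mp (hV k)).2, rightProd_one]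
    exact ih

lemma reconstruct_core (hU : ∀ k, U k ∈ unitary (QMatrix _ _))
    (hV : ∀ k, V k ∈ unitary (QMatrix _ _)) (T : QTensor I) :
    reconstruct hN U V (core hN U V T) = T := by
  rw [reconstruct, core, partialTensor, List.drop_zero, leftProds_rightProds,
    leftProds_reverse_leftProds hN hU, rightProds_rightProds_reverse hN hV]

variable {hN}

lemma IsFactors.unitary_left (h : IsFactors hN T U V) (k : Fin m) :
    U k ∈ unitary (QMatrix _ _) := by
  obtain ⟨σ, W, hk⟩ := h.left k
  exact hk.unitary_left

lemma IsFactors.unitary_right (h : IsFactors hN T U V) (k : Fin m) :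
    V k ∈ unitary (QMatrix _ _) := by
  obtain ⟨W, σ, hk⟩ := h.right k
  exact hk.unitary_right

/-- The real inner products of the slices in mode `p` are not changed by the factors in other
modes, on whichever side they act. -/
lemma IsFactors.re_innerL_core (h : IsFactors hN T U V) {p : Fin (n + 1)} {s : ℕ} (hs : s ≤ m)
    (hL : ∀ k : Fin m, k.val < s → leftMode hN k ≠ p)
    (hR : ∀ k : Fin m, k.val < s → rightMode hN k ≠ p) (α β : Fin (I p)) :
    (innerL (subtensor (core hN U V T) p α) (subtensor (core hN U V T) p β)).re =
      (innerL (subtensor (partialTensor hN U V T s) p α)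
        (subtensor (partialTensor hN U V T s) p β)).re := by
  induction s with
  | zero => rfl
  | succ s ih =>
    have e := partialTensor_eq hN U V T ⟨s, hs⟩
    rw [ih (by omega) (fun k hk => hL k (by omega)) (fun k hk => hR k (by omega)), e,
      innerL_subtensor_rightProd (hR ⟨s, hs⟩ (Nat.lt_succ_self s)) (h.unitary_right _),
      re_innerL_eq_re_innerR,
      innerR_subtensor_leftProd (hL ⟨s, hs⟩ (Nat.lt_succ_self s))
        (conjTranspose_mem_unitary (h.unitary_left _)),
      re_innerL_eq_re_innerR]

/-- In the mode `k` of the first half, the slices of the `k`-th partially multiplied tensor are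
left orthogonal, with the singular values as norms. -/
lemma IsFactors.innerL_partialTensor (h : IsFactors hN T U V) {k : Fin m} {σ : ℕ → ℝ}
    {W : QMatrix _ _} (hk : IsQSVD (leftMatrix hN U V T k) (U k) σ W)
    (α β : Fin (I (leftMode hN k))) :
    innerL (subtensor (partialTensor hN U V T k) (leftMode hN k) α)
        (subtensor (partialTensor hN U V T k) (leftMode hN k) β) =
      if α = β then ((σ α ^ 2 : ℝ) : ℍ[ℝ]) else 0 := by
  rw [partialTensor_eq, innerL_subtensor_rightProd (leftMode_ne_rightMode hN k k).symm
    (h.unitary_right k), innerL_subtensor, unfoldL_leftProd]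
  exact (congrFun (congrFun hk.mul_conjTranspose_self α) β).trans (Matrix.diagonal_apply ..)

/-- In the mode paired with `k`, the slices of the `k`-th partially multiplied tensor are right
orthogonal, with the singular values as norms. -/
lemma IsFactors.innerR_partialTensor (h : IsFactors hN T U V) {k : Fin m} {σ : ℕ → ℝ}
    {W : QMatrix _ _} (hk : IsQSVD (rightMatrix hN U V T k) W σ (V k))
    (α β : Fin (I (rightMode hN k))) :
    innerR (subtensor (partialTensor hN U V T k) (rightMode hN k) α)
        (subtensor (partialTensor hN U V T k) (rightMode hN k) β) =
      if α = β then ((σ α ^ 2 : ℝ) : ℍ[ℝ]) else 0 := by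
  rw [partialTensor_eq, ← leftProd_rightProd (leftMode_ne_rightMode hN k k),
    innerR_subtensor_leftProd (leftMode_ne_rightMode hN k k)
    (conjTranspose_mem_unitary (h.unitary_left k)), innerR_subtensor, unfoldR_rightProd]
  exact (congrFun (congrFun hk.conjTranspose_mul_self α) β).trans (Matrix.diagonal_apply ..)

lemma IsFactors.re_innerL_core_leftMode (h : IsFactors hN T U V) {k : Fin m} {σ : ℕ → ℝ}
    {W : QMatrix _ _} (hk : IsQSVD (leftMatrix hN U V T k) (U k) σ W)
    (α β : Fin (I (leftMode hN k))) :
    (innerL (subtensor (core hN U V T) (leftMode hN k) α)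
        (subtensor (core hN U V T) (leftMode hN k) β)).re = if α = β then σ α ^ 2 else 0 := by
  rw [h.re_innerL_core (s := k) k.isLt.le, h.innerL_partialTensor hk]
  · split_ifs
    exacts [Quaternion.re_coe _, rfl]
  · exact fun j hj he => hj.ne (congrArg Fin.val (leftMode_injective hN he))
  · exact fun j _ => (leftMode_ne_rightMode hN k j).symm

lemma IsFactors.re_innerL_core_rightMode (h : IsFactors hN T U V) {k : Fin m} {σ : ℕ → ℝ}
    {W : QMatrix _ _} (hk : IsQSVD (rightMatrix hN U V T k) W σ (V k))
    (α β : Fin (I (rightMode hN k))) :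
    (innerL (subtensor (core hN U V T) (rightMode hN k) α)
        (subtensor (core hN U V T) (rightMode hN k) β)).re = if α = β then σ α ^ 2 else 0 := by
  rw [h.re_innerL_core (s := k) k.isLt.le, re_innerL_eq_re_innerR, h.innerR_partialTensor hk]
  · split_ifs
    exacts [Quaternion.re_coe _, rfl]
  · exact fun j _ => leftMode_ne_rightMode hN j k
  · exact fun j hj he => hj.ne (congrArg Fin.val (rightMode_injective hN he))

lemma IsFactors.weaklyOrthogonal (h : IsFactors hN T U V) (p : Fin (n + 1)) {α β : Fin (I p)}
    (hαβ : α ≠ β) :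
    WeaklyOrthogonal (subtensor (core hN U V T) p α) (subtensor (core hN U V T) p β) := by
  have hre : (innerL (subtensor (core hN U V T) p α) (subtensor (core hN U V T) p β)).re = 0 := by
    obtain ⟨k, rfl | rfl⟩ := exists_eq_leftMode_or_rightMode hN p
    · obtain ⟨σ, W, hk⟩ := h.left k
      rw [h.re_innerL_core_leftMode hk, if_neg hαβ]
    · obtain ⟨W, σ, hk⟩ := h.right k
      rw [h.re_innerL_core_rightMode hk, if_neg hαβ]
  exact ⟨hre, (re_innerL_eq_re_innerR _ _).symm.trans hre⟩

/-- In the first mode nothing is applied after the pair `0`, so the full inner product vanishes. -/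
lemma IsFactors.leftOrthogonal (h : IsFactors hN T U V) {p : Fin (n + 1)} (hp : p.val = 0)
    {α β : Fin (I p)} (hαβ : α ≠ β) :
    LeftOrthogonal (subtensor (core hN U V T) p α) (subtensor (core hN U V T) p β) := by
  have hm : 0 < m := by omega
  obtain rfl : p = leftMode hN ⟨0, hm⟩ := Fin.ext hp
  obtain ⟨σ, W, hk⟩ := h.left ⟨0, hm⟩
  exact (h.innerL_partialTensor hk α β).trans (if_neg hαβ)

lemma IsFactors.rightOrthogonal (h : IsFactors hN T U V) {p : Fin (n + 1)} (hp : p.val = n)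
    {α β : Fin (I p)} (hαβ : α ≠ β) :
    RightOrthogonal (subtensor (core hN U V T) p α) (subtensor (core hN U V T) p β) := by
  have hm : 0 < m := by omega
  obtain rfl : p = rightMode hN ⟨0, hm⟩ := Fin.ext (by simp [rightMode, leftMode, hp])
  obtain ⟨W, σ, hk⟩ := h.right ⟨0, hm⟩
  exact (h.innerR_partialTensor hk α β).trans (if_neg hαβ)

end Properties

end TSQHOSVD

theorem theorem4p2 {n m : ℕ} (hN : n + 1 = 2 * m) (I : Fin (n + 1) → ℕ) (T : QTensor I) :
    (∃ (U : LeftFactors hN I) (V : RightFactors hN I), IsFactors hN T U V) ∧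
    ∀ (U : LeftFactors hN I) (V : RightFactors hN I), IsFactors hN T U V →
      -- factorization
      T = reconstruct hN U V (core hN U V T) ∧
      -- ordering, in the modes of the first and of the second half
      (∀ k : Fin m,
        (∀ σ : ℕ → ℝ, IsSingularValues (leftMatrix hN U V T k) σ →
          ∀ α, frobNorm (subtensor (core hN U V T) (leftMode hN k) α) = σ α.val) ∧
        Antitone (fun α => frobNorm (subtensor (core hN U V T) (leftMode hN k) α)) ∧
        ∀ α, 0 ≤ frobNorm (subtensor (core hN U V T) (leftMode hN k) α)) ∧
      (∀ k : Fin m,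
        (∀ σ : ℕ → ℝ, IsSingularValues (rightMatrix hN U V T k) σ →
          ∀ α, frobNorm (subtensor (core hN U V T) (rightMode hN k) α) = σ α.val) ∧
        Antitone (fun α => frobNorm (subtensor (core hN U V T) (rightMode hN k) α)) ∧
        ∀ α, 0 ≤ frobNorm (subtensor (core hN U V T) (rightMode hN k) α)) ∧
      -- orthogonality in the first and in the last mode
      (∀ α β : Fin (I 0), α ≠ β →
        LeftOrthogonal (subtensor (core hN U V T) 0 α) (subtensor (core hN U V T) 0 β)) ∧
      (∀ α β : Fin (I (Fin.last n)), α ≠ β →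
        RightOrthogonal (subtensor (core hN U V T) (Fin.last n) α)
          (subtensor (core hN U V T) (Fin.last n) β)) ∧
      -- weak orthogonality in every mode
      (∀ (k : Fin (n + 1)) (α β : Fin (I k)), α ≠ β →
        WeaklyOrthogonal (subtensor (core hN U V T) k α) (subtensor (core hN U V T) k β)) := by
  refine ⟨exists_isFactors hN T, fun U V h => ⟨?_, fun k => ?_, fun k => ?_, ?_, ?_, ?_⟩⟩
  · exact (reconstruct_core hN h.unitary_left h.unitary_right T).symm
  · obtain ⟨σ, W, hk⟩ := h.left k
    have hσ (α) : frobNorm (subtensor (core hN U V T) (leftMode hN k) α) = σ α.val :=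
      frobNorm_eq_of_re_innerL (hk.nonneg _)
        ((h.re_innerL_core_leftMode hk α α).trans (if_pos rfl))
    refine ⟨?_, fun α β hαβ => ?_, fun α => Real.sqrt_nonneg _⟩
    · rintro τ ⟨U', W', hτ⟩ α
      rw [hσ, hk.singularValues_unique hτ]
    · simp only [hσ]
      exact hk.antitone hαβ
  · obtain ⟨W, σ, hk⟩ := h.right k
    have hσ (α) : frobNorm (subtensor (core hN U V T) (rightMode hN k) α) = σ α.val :=
      frobNorm_eq_of_re_innerL (hk.nonneg _)
        ((h.re_innerL_core_rightMode hk α α).trans (if_pos rfl))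
    refine ⟨?_, fun α β hαβ => ?_, fun α => Real.sqrt_nonneg _⟩
    · rintro τ ⟨U', W', hτ⟩ α
      rw [hσ, hk.singularValues_unique hτ]
    · simp only [hσ]
      exact hk.antitone hαβ
  · exact fun α β hαβ => h.leftOrthogonal (p := 0) rfl hαβ
  · exact fun α β hαβ => h.rightOrthogonal (p := Fin.last n) rfl hαβ
  · exact fun p α β => h.weaklyOrthogonal p
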